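/- Let $m\ge 1$ be an integer. Let $(X_t)_{t\ge 0}$ be the Galton--Watson branching process in random environment with $X_0=1$ in which the environments $r_0,r_1,\dots$ are independent and uniformly distributed on $(0,1)$ and, given the environments, the individuals reproduce independently, every individual of generation $t$ having offspring probability generating function $P_{r_t}(z)=z\,(r_t+(1-r_t)z)^m$. Then $\mathbb P(X_t=1)>0$ for all $t$, for every $n\ge 1$ the limit $$\varphi_n=\lim_{t\to\infty}\frac{\mathbb P(X_t=n)}{\mathbb P(X_t=1)}$$ exists, and $$\varphi_n=\frac{m^2}{(m+1)(m-\ln(m+1))}\,\bigl(n+\psi_n+\varepsilon_n\bigr),\qquad \varepsilon_n\to 0\ \text{ as } n\to\infty,$$ where $(\psi_n)_{n\ge1}$ is the $(m+1)$-periodic sequence determined by $$\psi_n=\begin{cases}\psi_{n-1}+\frac1m,& m+1\nmid n-1,\\ \psi_{n-1}-1,& m+1\mid n-1,\end{cases}\quad (n\ge 2),\qquad \psi_{m+1}=\frac{m+1}{2m}\cdot\frac{(m+2)\ln(m+1)-2m}{(m+1)\ln(m+1)-m}.$$ -/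

import Mathlib

open Filter Topology MeasureTheory ProbabilityTheory

/-- `X` is a Galton-Watson branching process in an i.i.d. random environment on `(Ω, Pr)`.
* `μ` is the law of the environment parameter on `R`, and `P r` is the probability generating
  function of the offspring number in environment `r`: its `k`-th coefficient is the probability
  of producing `k` children.
* `env t` is the environment at time `t`, common to all individuals of generation `t`.
* `ξ t j` is the number of children of the `j`-th individual of generation `t`. -/
structure IsGaltonWatsonInRandomEnvironment {Ω R : Type*} [MeasurableSpace Ω] [MeasurableSpace R]
    (Pr : Measure Ω) (μ : Measure R) (P : R → PowerSeries ℝ)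
    (env : ℕ → Ω → R) (ξ : ℕ → ℕ → Ω → ℕ) (X : ℕ → Ω → ℕ) : Prop where
  measurable_env : ∀ t, Measurable (env t)
  measurable_offspring : ∀ t j, Measurable (ξ t j)
  /-- The environments at different times are independent. -/
  indep_env : iIndepFun env Pr
  /-- Each environment has law `μ`. -/
  law_env : ∀ t, Pr.map (env t) = μ
  /-- Given the whole environment sequence, the offspring numbers are independent, and `ξ t j` has
  generating function `P (env t)`. -/
  law_offspring : ∀ (A : Set (ℕ → R)), MeasurableSet A →
    ∀ (S : Finset (ℕ × ℕ)) (k : ℕ × ℕ → ℕ),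
      Pr.real {ω | (fun t => env t ω) ∈ A ∧ ∀ s ∈ S, ξ s.1 s.2 ω = k s} =
        ∫ ω in {ω | (fun t => env t ω) ∈ A},
          ∏ s ∈ S, PowerSeries.coeff (k s) (P (env s.1 ω)) ∂Pr
  /-- The process starts from one individual. -/
  start : ∀ ω, X 0 ω = 1
  /-- The next generation consists of the children of the current one. -/
  step : ∀ t ω, X (t + 1) ω = ∑ j ∈ Finset.range (X t ω), ξ t j ω

/-- The binomial kernel `P_r(z) = z (r + (1 - r) z) ^ m`. -/
noncomputable def binomialKernel (m : ℕ) (r : ℝ) : PowerSeries ℝ :=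
  PowerSeries.X * (PowerSeries.C r + PowerSeries.C (1 - r) * PowerSeries.X) ^ m

/-- The uniform distribution on `(0, 1)`. -/
noncomputable def uniformUnit : Measure ℝ := volume.restrict (Set.Ioo (0 : ℝ) 1)

/-! Averaging the kernel over the environment turns binomial weights into integrals of Bernstein
polynomials of degree `m * k`, all equal to `1 / (m * k + 1)`. So the population is a Markov chain
jumping from `k` to a uniform point of `{k, …, (m + 1) k}`, and the ratios to `P(X_t = 1) = (m +
1)⁻ᵗ` obey a triangular linear recursion in `t`. Its diagonal coefficient at `n ≥ 2` is below 1, so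
the limits `φ n` exist and satisfy the fixed-point equation.

Put `g k = φ k / (m * k + 1)` and let `k` run over the window `(N / (m + 1), N]`. The fixed-point
equation reads `m N g (N + 1) = (m + 1) ∑ g k`. It implies `g (N + 1) = 1 / (m + 1) + (1 / m) ∑ g k
/ k`, where the normalisation `φ 1 = 1` enters. For the rescaled error `k (g k - c)` each of the two
has asymptotic total weight 1, so neither contracts. The combination in
`mul_eq_add_weighted_sum_window` has total weight tending to `κ = (m + 1) (m - log (m + 1)) / m²`,
which is below 1 because `m < (m + 1) log (m + 1)`.

Insert `g k ≈ c (1 + limitOscillation m k / k)`. The oscillation comes from `N ∑ 1 / k = N log (m +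
1) + N % (m + 1) - m / 2 + o(1)`. On the right its mean-zero part is averaged out, so only its mean
has to solve a fixed-point equation. What remains is a contraction with vanishing source, handled by
`tendsto_zero_of_window_contraction`. -/

/-! ### Contractions over sliding windows. -/

/-- The sequence is bounded, and since `lo` tends to infinity an eventual bound `B` improves to `κ *
B + δ`. The infimum of the eventual bounds, which is the limsup, must then vanish. -/
theorem tendsto_zero_of_window_contraction {e ρ : ℕ → ℝ} {lo : ℕ → ℕ} {κ : ℝ} (hκ0 : 0 ≤ κ)
    (hκ : κ < 1) (he : ∀ n, 0 ≤ e n) (hlo : Tendsto lo atTop atTop)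
    (hρ : Tendsto ρ atTop (𝓝 0))
    (h : ∀ᶠ N in atTop, ∀ B, 0 ≤ B → (∀ k, lo N ≤ k → k ≤ N → e k ≤ B) →
      e (N + 1) ≤ κ * B + ρ N) : Tendsto e atTop (𝓝 0) := by
  have bdd : ∃ B, 0 ≤ B ∧ ∀ n, e n ≤ B := by
    obtain ⟨N₀, hN₀⟩ := eventually_atTop.1 (h.and (hρ.eventually (gt_mem_nhds zero_lt_one)))
    have hκ' : 0 < 1 - κ := by linarith
    -- The sum dominates the initial values; the second summand makes `κ * B + 1 ≤ B`.
    set B := (∑ k ∈ Finset.range (N₀ + 1), e k) + 1 / (1 - κ) with hB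
    have hs : 0 ≤ ∑ k ∈ Finset.range (N₀ + 1), e k := Finset.sum_nonneg fun k _ => he k
    have hB0 : 0 ≤ B := by positivity
    have hB1 : κ * B + 1 ≤ B := by
      have : (1 - κ) * (1 / (1 - κ)) = 1 := by field_simp
      nlinarith
    refine ⟨B, hB0, fun n => ?_⟩
    induction n using Nat.strong_induction_on with
    | _ n ih =>
      rcases Nat.lt_or_ge n (N₀ + 1) with hn | hn
      · have h1 := Finset.single_le_sum (f := e) (fun k _ => he k) (Finset.mem_range.2 hn)
        have : 0 ≤ 1 / (1 - κ) := by positivity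
        linarith
      · obtain ⟨N, rfl⟩ : ∃ N, n = N + 1 := ⟨n - 1, by omega⟩
        obtain ⟨h1, h2⟩ := hN₀ N (by omega)
        have := h1 B hB0 fun k _ hk => ih k (by omega)
        linarith
  have step : ∀ B, 0 ≤ B → (∀ᶠ n in atTop, e n ≤ B) → ∀ δ > 0, ∀ᶠ n in atTop, e n ≤ κ * B + δ := by
    intro B hB0 hB δ hδ
    obtain ⟨N₁, hN₁⟩ := eventually_atTop.1 hB
    obtain ⟨N₂, hN₂⟩ := eventually_atTop.1
      ((h.and (hρ.eventually (gt_mem_nhds hδ))).and (hlo.eventually_ge_atTop N₁))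
    refine eventually_atTop.2 ⟨N₂ + 1, fun n hn => ?_⟩
    obtain ⟨N, rfl⟩ : ∃ N, n = N + 1 := ⟨n - 1, by omega⟩
    obtain ⟨⟨h1, h2⟩, h3⟩ := hN₂ N (by omega)
    have := h1 B hB0 fun k hk _ => hN₁ k (h3.trans hk)
    linarith
  obtain ⟨B, hB0, hB⟩ := bdd
  set s : Set ℝ := {B | 0 ≤ B ∧ ∀ᶠ n in atTop, e n ≤ B}
  have hsne : s.Nonempty := ⟨B, hB0, .of_forall hB⟩
  have hsb : BddBelow s := ⟨0, fun x hx => hx.1⟩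
  have hs0 : sInf s ≤ 0 := by
    by_contra! hpos
    set η := (1 - κ) * sInf s / 4 with hη
    have hη0 : 0 < η := by have : 0 < 1 - κ := by linarith
                           positivity
    obtain ⟨C, hC, hCs⟩ := exists_lt_of_csInf_lt hsne (lt_add_of_pos_right (sInf s) hη0)
    have hm : κ * C + η ∈ s :=
      ⟨by have := hC.1; positivity, step C hC.1 hC.2 η hη0⟩
    have := csInf_le hsb hm
    have : κ * C ≤ κ * (sInf s + η) := by gcongr
    nlinarith
  rw [tendsto_order]
  refine ⟨fun a ha => .of_forall fun n => ha.trans_le (he n), fun a ha => ?_⟩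
  obtain ⟨C, hC, hCs⟩ := exists_lt_of_csInf_lt hsne (hs0.trans_lt ha)
  exact hC.2.mono fun n hn => hn.trans_lt hCs

/-! ### Asymptotics of sums over the window `(N / (m + 1), N]`. -/

/-- One step of Euler–Maclaurin for `1 / k`. A cubic error is needed: summed over a window of length
of order `N` and multiplied by `N`, it still tends to 0. -/
theorem abs_inv_sub_log_sub_le {j : ℕ} (hj : 1 ≤ j) :
    |((j + 1 : ℕ) : ℝ)⁻¹ - (Real.log (j + 1 : ℕ) - Real.log j)
      - ((2 * ((j + 1 : ℕ) : ℝ))⁻¹ - (2 * (j : ℝ))⁻¹)| ≤ 3 / (j : ℝ) ^ 3 := by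
  have hj' : (1 : ℝ) ≤ j := by exact_mod_cast hj
  have hj0 : (0 : ℝ) < j := by linarith
  set x : ℝ := ((j + 1 : ℕ) : ℝ)⁻¹ with hx
  have hx0 : 0 < x := by positivity
  have hxe : x = 1 / ((j : ℝ) + 1) := by rw [hx]; push_cast; simp
  have hx1 : 1 - x = j / (j + 1) := by rw [hxe]; field_simp; ring
  have hlog : Real.log (1 - x) = Real.log j - Real.log (j + 1 : ℕ) := by
    rw [hx1, Real.log_div (by positivity) (by positivity)]; push_cast; rfl
  have hxl : |x| < 1 := by
    rw [abs_of_pos hx0, hxe, div_lt_one (by positivity)]; linarith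
  have h1 := Real.abs_log_sub_add_sum_range_le hxl 2
  rw [abs_of_pos hx0, hx1] at h1
  simp only [Finset.sum_range_succ, Finset.sum_range_zero] at h1
  rw [← hx1, hlog] at h1
  norm_num at h1
  have e2 : ((2 * ((j + 1 : ℕ) : ℝ))⁻¹ - (2 * (j : ℝ))⁻¹) = - (x ^ 2 / 2) - 1 / (2 * j * (j + 1) ^ 2) := by
    rw [hxe]; push_cast; field_simp; ring
  have b1 : x ^ 3 / (1 - x) ≤ 2 / (j : ℝ) ^ 3 := by
    rw [hx1, hxe, div_div_eq_mul_div, div_le_div_iff₀ (by positivity) (by positivity)]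
    rw [div_pow, one_pow, div_mul_eq_mul_div, div_mul_eq_mul_div, div_le_iff₀ (by positivity)]
    nlinarith [pow_pos hj0 3, pow_pos hj0 2]
  have b2 : 1 / (2 * (j : ℝ) * (j + 1) ^ 2) ≤ 1 / (j : ℝ) ^ 3 := by
    apply one_div_le_one_div_of_le (by positivity)
    nlinarith [pow_pos hj0 3, pow_pos hj0 2]
  have b3 : 0 < 1 / (2 * (j : ℝ) * (j + 1) ^ 2) := by positivity
  have b4 : 3 / (j : ℝ) ^ 3 = 2 / (j : ℝ) ^ 3 + 1 / (j : ℝ) ^ 3 := by ring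
  rw [e2, b4]
  rw [abs_le] at h1 ⊢
  constructor <;> push_cast at h1 ⊢ <;> linarith [h1.1, h1.2]

theorem abs_sum_inv_sub_log_sub_le {q N : ℕ} (hq : 1 ≤ q) (hN : q ≤ N) :
    |∑ k ∈ Finset.Ioc q N, (k : ℝ)⁻¹ - (Real.log N - Real.log q)
      - ((2 * (N : ℝ))⁻¹ - (2 * (q : ℝ))⁻¹)| ≤ 3 * (N - q) / (q : ℝ) ^ 3 := by
  induction N, hN using Nat.le_induction with
  | base => simp
  | succ N hN ih =>
    have h1 := abs_inv_sub_log_sub_le (hq.trans hN)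
    have hq0 : (0 : ℝ) < q := by exact_mod_cast hq
    have h2 : 3 / (N : ℝ) ^ 3 ≤ 3 / (q : ℝ) ^ 3 := by gcongr
    rw [← Finset.insert_Ioc_right_eq_Ioc_add_one hN, Finset.sum_insert (by simp)]
    have h3 := h1.trans h2
    have h4 : 3 * (((N + 1 : ℕ) : ℝ) - q) / (q : ℝ) ^ 3 =
        3 * ((N : ℝ) - q) / (q : ℝ) ^ 3 + 3 / (q : ℝ) ^ 3 := by push_cast; ring
    rw [h4]
    rw [abs_le] at *
    constructor <;> linarith [h3.1, h3.2, ih.1, ih.2]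

section Window

variable (m : ℕ)

theorem window_index_facts {m N : ℕ} (hN : m + 1 ≤ N) :
    (1 : ℝ) ≤ (N / (m + 1) : ℕ) ∧
    (N : ℝ) = (m + 1) * (N / (m + 1) : ℕ) + (N % (m + 1) : ℕ) ∧
    ((N % (m + 1) : ℕ) : ℝ) ≤ m := by
  refine ⟨?_, ?_, ?_⟩
  · exact_mod_cast Nat.div_pos hN (by omega)
  · exact_mod_cast (Nat.div_add_mod N (m + 1)).symm
  · exact_mod_cast Nat.lt_succ_iff.1 (Nat.mod_lt N (Nat.succ_pos m))

theorem tendsto_natCast_div_atTop :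
    Tendsto (fun N : ℕ => ((N / (m + 1) : ℕ) : ℝ)) atTop atTop :=
  tendsto_natCast_atTop_atTop.comp (Nat.tendsto_div_const_atTop (by omega))

theorem tendsto_mul_sum_inv_window :
    Tendsto (fun N : ℕ => N * ∑ k ∈ Finset.Ioc (N / (m + 1)) N, (k : ℝ)⁻¹
      - (N * Real.log (m + 1) + (N % (m + 1) : ℕ) - m / 2)) atTop (𝓝 0) := by
  have hK : Tendsto (fun N : ℕ => (12 * ((m : ℝ) + 1) ^ 2 + (m + 1) ^ 2 + m) /
      ((N / (m + 1) : ℕ) : ℝ)) atTop (𝓝 0) := (tendsto_natCast_div_atTop m).const_div_atTop _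
  refine squeeze_zero_norm' ?_ hK
  filter_upwards [eventually_ge_atTop (m + 1)] with N hN
  obtain ⟨hq1, hNq, hs⟩ := window_index_facts hN
  have hqN : N / (m + 1) ≤ N := Nat.div_le_self _ _
  have h := abs_sum_inv_sub_log_sub_le (by exact_mod_cast hq1) hqN
  set S := ∑ k ∈ Finset.Ioc (N / (m + 1)) N, (k : ℝ)⁻¹
  have hs0 : (0 : ℝ) ≤ ((N % (m + 1) : ℕ) : ℝ) := by positivity
  generalize ((N % (m + 1) : ℕ) : ℝ) = s at *
  generalize ((N / (m + 1) : ℕ) : ℝ) = q at *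
  have hm0 : (0 : ℝ) ≤ m := by positivity
  have hq0 : 0 < q := by linarith
  -- With `N = (m + 1) q + s = (m + 1) q (1 + x)`, the logarithm splits into `log (m + 1)` and `log
  -- (1 + x)`, and `N log (1 + x) = s + O(1 / q)`.
  set n : ℝ := (N : ℝ) with hn
  have hn0 : 0 < n := by rw [hNq]; positivity
  set x := s / ((m + 1) * q) with hx
  have hx0 : 0 ≤ x := by positivity
  have hnx : n = (m + 1) * q * (1 + x) := by rw [hNq, hx]; field_simp
  have hsx : s = (m + 1) * q * x := by rw [hx]; field_simp
  have hlog : Real.log n - Real.log q = Real.log (m + 1) + Real.log (1 + x) := by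
    rw [hnx, Real.log_mul (by positivity) (by positivity), Real.log_mul (by positivity) (by positivity)]
    ring
  have hl1 : n * Real.log (1 + x) - s ≤ (m + 1) ^ 2 / q := by
    have h1 : Real.log (1 + x) ≤ x := by
      have := Real.log_le_sub_one_of_pos (show 0 < 1 + x by positivity); linarith
    have h2 : n * Real.log (1 + x) ≤ n * x := by gcongr
    have h3 : n * x - s = s * x := by rw [hnx, hsx]; ring
    have h4 : s * x ≤ (m + 1) ^ 2 / q := by
      rw [hx, mul_div_assoc', div_le_div_iff₀ (by positivity) hq0]
      have : s * s ≤ (m+1) * (m+1) := by gcongr <;> linarith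
      have h5 : s * s * q ≤ (m+1) * (m+1) * q := by gcongr
      have h6 : (m+1 : ℝ) * (m+1) * q ≤ (m+1) ^ 2 * ((m+1) * q) := by
        have : (0:ℝ) ≤ m * ((m+1)^2 * q) := by positivity
        nlinarith
      linarith
    linarith
  have hl2 : 0 ≤ n * Real.log (1 + x) - s := by
    have h1 := Real.one_sub_inv_le_log_of_pos (show 0 < 1 + x by positivity)
    have h2 : n * (1 - (1 + x)⁻¹) ≤ n * Real.log (1 + x) := by gcongr
    have h3 : n * (1 - (1 + x)⁻¹) = s := by rw [hnx, hsx]; field_simp; ring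
    linarith
  have hN2 : n ≤ 2 * (m + 1) * q := by rw [hNq]; nlinarith
  have hmain : n * (3 * (n - q) / q ^ 3) ≤ 12 * (m + 1) ^ 2 / q := by
    have h1 : n * (n - q) ≤ (2 * (m + 1) * q) * (2 * (m + 1) * q) := by
      have : n * (n - q) ≤ n * n := by nlinarith
      have : n * n ≤ (2 * (m + 1) * q) * (2 * (m + 1) * q) := by gcongr
      linarith
    rw [mul_div_assoc', div_le_div_iff₀ (by positivity) hq0]
    nlinarith [mul_le_mul_of_nonneg_right h1 hq0.le]
  have h2 := mul_le_mul_of_nonneg_left h hn0.le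
  rw [← abs_of_pos hn0, ← abs_mul, abs_of_pos hn0] at h2
  rw [hlog] at h2
  -- The boundary terms contribute `1 / 2 - (m + 1) / 2 = -m / 2`, up to `s / (2 * q)`.
  have e1 : n * (S - (Real.log (m + 1) + Real.log (1 + x)) - ((2 * n)⁻¹ - (2 * q)⁻¹)) =
      (n * S - (n * Real.log (m + 1) + s - m / 2)) - (n * Real.log (1 + x) - s) + s / (2 * q) := by
    have : n * (2 * q)⁻¹ = (m + 1) / 2 + s / (2 * q) := by rw [hNq]; field_simp
    have : n * (2 * n)⁻¹ = 1 / 2 := by field_simp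
    linear_combination this * (-1) + ‹n * (2 * q)⁻¹ = (m + 1) / 2 + s / (2 * q)›
  rw [e1] at h2
  have h3 : s / (2 * q) ≤ m / q := by
    rw [div_le_div_iff₀ (by positivity) hq0]; nlinarith
  have h4 : 0 ≤ s / (2 * q) := by positivity
  have h5 := h2.trans hmain
  rw [Real.norm_eq_abs, add_div, add_div]
  rw [abs_le] at h5 ⊢
  have : 0 ≤ (m : ℝ) / q := by positivity
  have : 0 ≤ ((m : ℝ) + 1) ^ 2 / q := by positivity
  constructor <;> linarith [h5.1, h5.2]

theorem tendsto_sum_inv_window :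
    Tendsto (fun N : ℕ => ∑ k ∈ Finset.Ioc (N / (m + 1)) N, (k : ℝ)⁻¹) atTop
      (𝓝 (Real.log (m + 1))) := by
  have h1 : Tendsto (fun N : ℕ => (1 : ℝ) / N) atTop (𝓝 0) := tendsto_one_div_atTop_nhds_zero_nat
  have h2 : Tendsto (fun N : ℕ => (((N % (m + 1) : ℕ) : ℝ) - m / 2) / N) atTop (𝓝 0) := by
    refine squeeze_zero_norm (a := fun N : ℕ => (2 * m : ℝ) / N) (fun N => ?_)
      (tendsto_const_div_atTop_nhds_zero_nat _)
    have : ((N % (m + 1) : ℕ) : ℝ) ≤ m := by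
      exact_mod_cast Nat.lt_succ_iff.1 (Nat.mod_lt N (Nat.succ_pos m))
    have : (0 : ℝ) ≤ ((N % (m + 1) : ℕ) : ℝ) := by positivity
    rw [norm_div, Real.norm_natCast]
    gcongr
    rw [Real.norm_eq_abs, abs_le]
    constructor <;> linarith
  have h3 := (((tendsto_mul_sum_inv_window m).mul h1).add h2).add_const (Real.log (m + 1))
  simp only [mul_zero, zero_add] at h3
  refine h3.congr' ?_
  filter_upwards [eventually_ge_atTop 1] with N hN
  have : (N : ℝ) ≠ 0 := by positivity
  field_simp
  ring

theorem sum_inv_sq_le {q N : ℕ} (hq : 1 ≤ q) (hN : q ≤ N) :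
    ∑ k ∈ Finset.Ioc q N, ((k : ℝ) ^ 2)⁻¹ ≤ (q : ℝ)⁻¹ - (N : ℝ)⁻¹ := by
  induction N, hN using Nat.le_induction with
  | base => simp
  | succ N hN ih =>
    rw [← Finset.insert_Ioc_right_eq_Ioc_add_one hN, Finset.sum_insert (by simp)]
    have : (0 : ℝ) < N := by exact_mod_cast hq.trans hN
    have : (((N + 1 : ℕ) : ℝ) ^ 2)⁻¹ ≤ (N : ℝ)⁻¹ - ((N + 1 : ℕ) : ℝ)⁻¹ := by
      push_cast
      rw [inv_sub_inv (by positivity) (by positivity), inv_eq_one_div,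
        div_le_div_iff₀ (by positivity) (by positivity)]
      nlinarith
    linarith

theorem le_sum_inv_sq {q N : ℕ} (hN : q ≤ N) :
    ((q : ℝ) + 1)⁻¹ - ((N : ℝ) + 1)⁻¹ ≤ ∑ k ∈ Finset.Ioc q N, ((k : ℝ) ^ 2)⁻¹ := by
  induction N, hN using Nat.le_induction with
  | base => simp
  | succ N hN ih =>
    rw [← Finset.insert_Ioc_right_eq_Ioc_add_one hN, Finset.sum_insert (by simp)]
    have : ((N : ℝ) + 1)⁻¹ - (((N + 1 : ℕ) : ℝ) + 1)⁻¹ ≤ (((N + 1 : ℕ) : ℝ) ^ 2)⁻¹ := by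
      push_cast
      rw [inv_sub_inv (by positivity) (by positivity), inv_eq_one_div,
        div_le_div_iff₀ (by positivity) (by positivity)]
      have : (0 : ℝ) ≤ N := by positivity
      nlinarith
    linarith

theorem tendsto_natCast_div_natCast_div :
    Tendsto (fun N : ℕ => (N : ℝ) / (N / (m + 1) : ℕ)) atTop (𝓝 (m + 1)) := by
  have h1 : Tendsto (fun N : ℕ => ((N % (m + 1) : ℕ) : ℝ) / (N / (m + 1) : ℕ)) atTop (𝓝 0) := by
    refine squeeze_zero (fun N => by positivity) (fun N => ?_)
      ((tendsto_natCast_div_atTop m).const_div_atTop (m : ℝ))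
    gcongr
    exact_mod_cast Nat.lt_succ_iff.1 (Nat.mod_lt N (Nat.succ_pos m))
  have h2 := h1.const_add ((m : ℝ) + 1)
  rw [add_zero] at h2
  refine h2.congr' ?_
  filter_upwards [eventually_ge_atTop (m + 1)] with N hN
  obtain ⟨hq1, hNq, hs⟩ := window_index_facts hN
  have hq0 : ((N / (m + 1) : ℕ) : ℝ) ≠ 0 := by linarith
  rw [eq_div_iff hq0, add_mul, div_mul_cancel₀ _ hq0]
  exact hNq.symm

theorem tendsto_mul_sum_inv_sq_window :
    Tendsto (fun N : ℕ => N * ∑ k ∈ Finset.Ioc (N / (m + 1)) N, ((k : ℝ) ^ 2)⁻¹) atTop (𝓝 m) := by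
  have hq := tendsto_natCast_div_natCast_div m
  have hup : Tendsto (fun N : ℕ => (N : ℝ) / (N / (m + 1) : ℕ) - 1) atTop (𝓝 m) := by
    simpa using hq.sub_const 1
  have hlow : Tendsto (fun N : ℕ => ((N : ℝ) / (N / (m + 1) : ℕ)) *
      (1 - 1 / (((N / (m + 1) : ℕ) : ℝ) + 1)) - 1) atTop (𝓝 m) := by
    have h1 : Tendsto (fun N : ℕ => 1 / (((N / (m + 1) : ℕ) : ℝ) + 1)) atTop (𝓝 0) :=
      (tendsto_atTop_add_const_right _ _ (tendsto_natCast_div_atTop m)).const_div_atTop 1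
    have := (hq.mul (h1.const_sub 1)).sub_const 1
    simpa using this
  refine tendsto_of_tendsto_of_tendsto_of_le_of_le' hlow hup ?_ ?_
  · filter_upwards [eventually_ge_atTop (m + 1)] with N hN
    obtain ⟨hq1, -, -⟩ := window_index_facts hN
    have h := le_sum_inv_sq (Nat.div_le_self N (m + 1))
    have hN0 : (0 : ℝ) < N := by exact_mod_cast (Nat.succ_pos m).trans_le hN
    refine le_trans ?_ (mul_le_mul_of_nonneg_left h hN0.le)
    have h2 : (N : ℝ) * ((N : ℝ) + 1)⁻¹ ≤ 1 := by
      rw [← div_eq_mul_inv, div_le_one (by positivity)]; linarith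
    have h3 : (N : ℝ) / (N / (m + 1) : ℕ) * (1 - 1 / (((N / (m + 1) : ℕ) : ℝ) + 1)) =
        N * (((N / (m + 1) : ℕ) : ℝ) + 1)⁻¹ := by
      have : ((N / (m + 1) : ℕ) : ℝ) ≠ 0 := by linarith
      field_simp; ring
    rw [h3, mul_sub]
    linarith
  · filter_upwards [eventually_ge_atTop (m + 1)] with N hN
    obtain ⟨hq1, -, -⟩ := window_index_facts hN
    have h := sum_inv_sq_le (by exact_mod_cast hq1) (Nat.div_le_self N (m + 1))
    have hN0 : (0 : ℝ) < N := by exact_mod_cast (Nat.succ_pos m).trans_le hN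
    refine (mul_le_mul_of_nonneg_left h hN0.le).trans_eq ?_
    rw [mul_sub, mul_inv_cancel₀ hN0.ne', ← div_eq_mul_inv]

theorem tendsto_sum_window_weight :
    Tendsto (fun N : ℕ => ∑ k ∈ Finset.Ioc (N / (m + 1)) N, ((N : ℝ) / k - 1) / k) atTop
      (𝓝 (m - Real.log (m + 1))) := by
  refine ((tendsto_mul_sum_inv_sq_window m).sub (tendsto_sum_inv_window m)).congr fun N => ?_
  rw [Finset.mul_sum, ← Finset.sum_sub_distrib]
  refine Finset.sum_congr rfl fun k hk => ?_
  have : (k : ℝ) ≠ 0 := by exact_mod_cast Nat.ne_zero_of_lt (Finset.mem_Ioc.1 hk).1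
  field_simp

/-- Abel summation: increments of a bounded sequence against nonincreasing weights cost only the
largest weight. -/
theorem abs_sum_mul_sub_le {w Θ : ℕ → ℝ} {B : ℝ} {q N : ℕ} (hB : ∀ k, |Θ k| ≤ B)
    (hw : ∀ k, q < k → k < N → w (k + 1) ≤ w k) (hN : q < N) (hw0 : 0 ≤ w N) :
    |∑ k ∈ Finset.Ioc q N, w k * (Θ k - Θ (k - 1))| ≤ 2 * B * w (q + 1) := by
  have hB0 : 0 ≤ B := (abs_nonneg _).trans (hB 0)
  have key : ∀ M, q + 1 ≤ M → M ≤ N →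
      |∑ k ∈ Finset.Ioc q M, w k * (Θ k - Θ (k - 1)) - w M * Θ M + w (q + 1) * Θ q|
        ≤ B * (w (q + 1) - w M) := by
    intro M hM
    induction M, hM using Nat.le_induction with
    | base => intro _; simp [mul_sub]
    | succ M hM ih =>
      intro hMN
      have h1 := ih (by omega)
      have h2 := hw M (by omega) (by omega)
      rw [← Finset.insert_Ioc_right_eq_Ioc_add_one (by omega), Finset.sum_insert (by simp)]
      have h3 : |(w M - w (M + 1)) * Θ M| ≤ (w M - w (M + 1)) * B := by
        rw [abs_mul, abs_of_nonneg (by linarith)]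
        exact mul_le_mul_of_nonneg_left (hB M) (by linarith)
      rw [Nat.add_sub_cancel]
      rw [abs_le] at h1 h3 ⊢
      constructor <;> linarith [h1.1, h1.2, h3.1, h3.2]
  have hmono : ∀ M, q + 1 ≤ M → M ≤ N → w M ≤ w (q + 1) := by
    intro M hM
    induction M, hM using Nat.le_induction with
    | base => intro _; rfl
    | succ M hM ih => intro h; exact (hw M (by omega) (by omega)).trans (ih (by omega))
  have h1 := key N hN le_rfl
  have hw1 : 0 ≤ w (q + 1) := hw0.trans (hmono N hN le_rfl)
  have h2 : |w N * Θ N| ≤ w N * B := by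
    rw [abs_mul, abs_of_nonneg hw0]; exact mul_le_mul_of_nonneg_left (hB N) hw0
  have h3 : |w (q + 1) * Θ q| ≤ w (q + 1) * B := by
    rw [abs_mul, abs_of_nonneg hw1]; exact mul_le_mul_of_nonneg_left (hB q) hw1
  rw [abs_le] at *
  constructor <;> nlinarith [h1.1, h1.2, h2.1, h2.2, h3.1, h3.2]

/-- The centred sawtooth has mean zero over a period, hence a periodic primitive: `s (s - 1 - m) /
2` vanishes at both `s = 0` and `s = m + 1`. -/
theorem mod_sub_half_eq_sub (i : ℕ) :
    ((i % (m + 1) : ℕ) : ℝ) - m / 2 =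
      ((((i + 1) % (m + 1) : ℕ) : ℝ) * (((i + 1) % (m + 1) : ℕ) - 1 - m)) / 2
        - (((i % (m + 1) : ℕ) : ℝ) * ((i % (m + 1) : ℕ) - 1 - m)) / 2 := by
  have hlt : i % (m + 1) < m + 1 := Nat.mod_lt i (Nat.succ_pos m)
  have h := Nat.add_mod_eq_ite (m := i) (n := 1) (k := m + 1)
  rcases Nat.eq_zero_or_pos m with rfl | hm
  · simp [Nat.mod_one]
  rw [Nat.mod_eq_of_lt (show 1 < m + 1 by omega)] at h
  split_ifs at h with h1
  · have h2 : i % (m + 1) = m := by omega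
    rw [h, h2]
    simp
    ring
  · rw [h]
    push_cast
    ring

theorem abs_mod_mul_le (i : ℕ) :
    |(((i % (m + 1) : ℕ) : ℝ) * ((i % (m + 1) : ℕ) - 1 - m)) / 2| ≤ ((m : ℝ) + 1) ^ 2 := by
  have h1 : ((i % (m + 1) : ℕ) : ℝ) ≤ m := by
    exact_mod_cast Nat.lt_succ_iff.1 (Nat.mod_lt i (Nat.succ_pos m))
  have h0 : (0 : ℝ) ≤ ((i % (m + 1) : ℕ) : ℝ) := by positivity
  generalize ((i % (m + 1) : ℕ) : ℝ) = s at *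
  rw [abs_le]
  constructor <;> nlinarith

theorem tendsto_sum_window_weight_mul_mod :
    Tendsto (fun N : ℕ => ∑ k ∈ Finset.Ioc (N / (m + 1)) N,
      ((N : ℝ) / k - 1) / k * ((((k - 1) % (m + 1) : ℕ) : ℝ) - m / 2)) atTop (𝓝 0) := by
  refine squeeze_zero_norm' (a := fun N : ℕ => 2 * ((m : ℝ) + 1) ^ 2 * (2 * (m + 1)) /
    ((N / (m + 1) : ℕ) : ℝ)) ?_ ((tendsto_natCast_div_atTop m).const_div_atTop _)
  filter_upwards [eventually_ge_atTop (m + 1), eventually_ge_atTop 2] with N hN hN2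
  obtain ⟨hq1, hNq, hs⟩ := window_index_facts hN
  have hq1' : 1 ≤ N / (m + 1) := by exact_mod_cast hq1
  -- For `m = 0` the window is empty.
  rcases Nat.eq_zero_or_pos m with hm | hm
  · subst hm
    simp
    positivity
  have hqN : N / (m + 1) < N := Nat.div_lt_self (by omega) (by omega)
  have hw : ∀ k, N / (m + 1) < k → k < N → ((N : ℝ) / (k + 1 : ℕ) - 1) / (k + 1 : ℕ) ≤
      ((N : ℝ) / k - 1) / k := by
    intro k hk hkN
    have hk0 : (0 : ℝ) < k := by exact_mod_cast (by omega : 0 < k)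
    have hkN' : (k : ℝ) + 1 ≤ N := by exact_mod_cast hkN
    have h1 : 0 ≤ (N : ℝ) / k - 1 := by
      rw [sub_nonneg, one_le_div hk0]; linarith
    push_cast
    gcongr <;> linarith
  have h := abs_sum_mul_sub_le (w := fun k => ((N : ℝ) / k - 1) / k)
    (Θ := fun i => (((i % (m + 1) : ℕ) : ℝ) * ((i % (m + 1) : ℕ) - 1 - m)) / 2)
    (abs_mod_mul_le m) hw hqN (by
      have : (N : ℝ) ≠ 0 := by positivity
      simp [this])
  have e : ∑ k ∈ Finset.Ioc (N / (m + 1)) N,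
      ((N : ℝ) / k - 1) / k * ((((k - 1) % (m + 1) : ℕ) : ℝ) - m / 2) =
      ∑ k ∈ Finset.Ioc (N / (m + 1)) N, ((N : ℝ) / k - 1) / k *
        ((((k % (m + 1) : ℕ) : ℝ) * ((k % (m + 1) : ℕ) - 1 - m)) / 2 -
        ((((k - 1) % (m + 1) : ℕ) : ℝ) * (((k - 1) % (m + 1) : ℕ) - 1 - m)) / 2) := by
    refine Finset.sum_congr rfl fun k hk => ?_
    have hk1 : k - 1 + 1 = k := by have := (Finset.mem_Ioc.1 hk).1; omega
    rw [mod_sub_half_eq_sub, hk1]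
  rw [Real.norm_eq_abs, e]
  refine h.trans ?_
  rw [mul_div_assoc]
  refine mul_le_mul_of_nonneg_left ?_ (by positivity)
  push_cast
  generalize ((N % (m + 1) : ℕ) : ℝ) = s at *
  generalize ((N / (m + 1) : ℕ) : ℝ) = q at *
  have hq0 : 0 < q := by linarith
  have h1 : (N : ℝ) / (q + 1) - 1 ≤ 2 * (m + 1) := by
    have : (N : ℝ) / (q + 1) ≤ 2 * (m + 1) := by
      rw [div_le_iff₀ (by positivity), hNq]; nlinarith
    linarith
  gcongr
  linarith

end Window

/-! ### Averaging the binomial kernel over the environment. -/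

/-- The integral does not depend on `ν`: the difference of two consecutive polynomials is, up to the
factor `n + 1`, the derivative of one of degree `n + 1` vanishing at 0 and 1. -/
theorem integral_bernsteinPolynomial_eval {n ν : ℕ} (h : ν ≤ n) :
    ∫ x in (0 : ℝ)..1, (bernsteinPolynomial ℝ n ν).eval x = 1 / ((n : ℝ) + 1) := by
  induction ν with
  | zero =>
    have h1 : ∀ x : ℝ, (bernsteinPolynomial ℝ n 0).eval x = (1 - x) ^ n := fun x => by
      simp [bernsteinPolynomial]
    simp only [h1]
    rw [intervalIntegral.integral_comp_sub_left (fun x => x ^ n) 1]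
    simp
  | succ ν ih =>
    rw [← ih (by omega)]
    have hd : ∫ x in (0 : ℝ)..1,
        (Polynomial.derivative (bernsteinPolynomial ℝ (n + 1) (ν + 1))).eval x = 0 := by
      rw [intervalIntegral.integral_eq_sub_of_hasDerivAt
        (fun x _ => (bernsteinPolynomial ℝ (n + 1) (ν + 1)).hasDerivAt x)
        ((Polynomial.continuous _).intervalIntegrable _ _),
        bernsteinPolynomial.eval_at_1, bernsteinPolynomial.eval_at_0, if_neg (by omega),
        if_neg (by omega), sub_zero]
    rw [bernsteinPolynomial.derivative_succ_aux] at hd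
    simp only [Polynomial.eval_mul, Polynomial.eval_add, Polynomial.eval_natCast,
      Polynomial.eval_one, Polynomial.eval_sub, intervalIntegral.integral_const_mul] at hd
    rw [intervalIntegral.integral_sub ((Polynomial.continuous _).intervalIntegrable _ _)
      ((Polynomial.continuous _).intervalIntegrable _ _)] at hd
    have : (n : ℝ) + 1 ≠ 0 := by positivity
    have := (mul_eq_zero.1 hd).resolve_left this
    linarith

theorem PowerSeries.coeff_C_add_C_mul_X_pow (a b : ℝ) (M j : ℕ) :
    PowerSeries.coeff j ((PowerSeries.C a + PowerSeries.C b * PowerSeries.X) ^ M) =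
      M.choose j * b ^ j * a ^ (M - j) := by
  have e : (PowerSeries.C a + PowerSeries.C b * PowerSeries.X) ^ M =
      ∑ i ∈ Finset.range (M + 1),
        PowerSeries.C (M.choose i * b ^ i * a ^ (M - i)) * PowerSeries.X ^ i := by
    rw [add_comm, add_pow]
    refine Finset.sum_congr rfl fun i _ => ?_
    rw [mul_pow, map_mul, map_mul, map_pow, map_pow, map_natCast]
    ring
  rw [e, map_sum]
  simp only [PowerSeries.coeff_C_mul_X_pow]
  rw [Finset.sum_ite_eq]
  split_ifs with h
  · rfl
  · rw [Nat.choose_eq_zero_of_lt (by simpa using h)]; simp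

theorem coeff_binomialKernel_pow (m k n : ℕ) (r : ℝ) :
    PowerSeries.coeff n (binomialKernel m r ^ k) =
      if k ≤ n ∧ n ≤ (m + 1) * k then
        (bernsteinPolynomial ℝ (m * k) (m * k - (n - k))).eval r else 0 := by
  rw [binomialKernel, mul_pow, ← pow_mul, PowerSeries.coeff_X_pow_mul',
    PowerSeries.coeff_C_add_C_mul_X_pow]
  by_cases h1 : k ≤ n
  · by_cases h2 : n ≤ (m + 1) * k
    · have h3 : n - k ≤ m * k := by
        rw [add_mul] at h2; omega
      rw [if_pos h1, if_pos ⟨h1, h2⟩, bernsteinPolynomial]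
      simp only [Polynomial.eval_mul, Polynomial.eval_natCast, Polynomial.eval_pow,
        Polynomial.eval_X, Polynomial.eval_sub, Polynomial.eval_one]
      rw [Nat.choose_symm h3, Nat.sub_sub_self h3]
      ring
    · rw [if_pos h1, if_neg (by tauto), Nat.choose_eq_zero_of_lt (by rw [add_mul] at h2; omega)]
      simp
  · rw [if_neg h1, if_neg (by tauto)]

theorem integral_coeff_binomialKernel_pow (m k n : ℕ) :
    ∫ r, PowerSeries.coeff n (binomialKernel m r ^ k) ∂uniformUnit =
      if k ≤ n ∧ n ≤ (m + 1) * k then 1 / ((m : ℝ) * k + 1) else 0 := by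
  simp only [coeff_binomialKernel_pow]
  split_ifs with h
  · rw [uniformUnit, ← integral_Ioc_eq_integral_Ioo, ← intervalIntegral.integral_of_le zero_le_one,
      integral_bernsteinPolynomial_eval (Nat.sub_le _ _)]
    push_cast; rfl
  · simp

theorem continuous_coeff_binomialKernel (m n : ℕ) :
    Continuous fun r => PowerSeries.coeff n (binomialKernel m r) := by
  have : (fun r => PowerSeries.coeff n (binomialKernel m r)) = fun r =>
      if 1 ≤ n ∧ n ≤ (m + 1) * 1 then
        (bernsteinPolynomial ℝ (m * 1) (m * 1 - (n - 1))).eval r else 0 := by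
    funext r
    rw [← coeff_binomialKernel_pow, pow_one]
  rw [this]
  split_ifs
  · exact Polynomial.continuous _
  · exact continuous_const

theorem integrable_uniformUnit_of_continuous {f : ℝ → ℝ} (hf : Continuous f) :
    Integrable f uniformUnit :=
  (hf.integrableOn_Icc (a := 0) (b := 1)).mono_set Set.Ioo_subset_Icc_self

/-! ### The population size as a Markov chain. -/

section BranchingProcess

variable {Ω : Type*} [MeasurableSpace Ω] {Pr : Measure Ω} {m : ℕ}
  {env : ℕ → Ω → ℝ} {ξ : ℕ → ℕ → Ω → ℕ} {X : ℕ → Ω → ℕ}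

namespace IsGaltonWatsonInRandomEnvironment

variable (hX : IsGaltonWatsonInRandomEnvironment Pr uniformUnit (binomialKernel m) env ξ X)
include hX

theorem measureReal_offspring (S : Finset (ℕ × ℕ)) (v : ℕ × ℕ → ℕ) :
    Pr.real {ω | ∀ s ∈ S, ξ s.1 s.2 ω = v s} =
      ∫ ω, ∏ s ∈ S, PowerSeries.coeff (v s) (binomialKernel m (env s.1 ω)) ∂Pr := by
  simpa using hX.law_offspring Set.univ .univ S v

theorem measurableSet_offspring (S : Finset (ℕ × ℕ)) (v : ℕ × ℕ → ℕ) :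
    MeasurableSet {ω | ∀ s ∈ S, ξ s.1 s.2 ω = v s} := by
  have : {ω | ∀ s ∈ S, ξ s.1 s.2 ω = v s} = ⋂ s ∈ S, {ω | ξ s.1 s.2 ω = v s} := by ext; simp
  rw [this]
  exact Finset.measurableSet_biInter _ fun s _ =>
    measurableSet_eq_fun (hX.measurable_offspring s.1 s.2) measurable_const

/-- Offspring numbers of different generations are independent. -/
theorem measureReal_offspring_union {S T : Finset (ℕ × ℕ)} (t : ℕ) (hS : ∀ s ∈ S, s.1 = t)
    (hT : ∀ s ∈ T, t < s.1) (v : ℕ × ℕ → ℕ) :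
    Pr.real {ω | ∀ s ∈ S ∪ T, ξ s.1 s.2 ω = v s} =
      Pr.real {ω | ∀ s ∈ S, ξ s.1 s.2 ω = v s} * Pr.real {ω | ∀ s ∈ T, ξ s.1 s.2 ω = v s} := by
  classical
  have hd : Disjoint S T := Finset.disjoint_left.2 fun s h1 h2 => by
    have := hS s h1; have := hT s h2; omega
  rw [hX.measureReal_offspring, hX.measureReal_offspring, hX.measureReal_offspring]
  simp only [Finset.prod_union hd]
  -- The two products depend on environments at disjoint sets of times, so they are independent.
  have hdt : Disjoint {t} (T.image Prod.fst) := by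
    rw [Finset.disjoint_singleton_left, Finset.mem_image]
    rintro ⟨s, h1, h2⟩
    have := hT s h1; omega
  have hind := hX.indep_env.indepFun_finset _ _ hdt hX.measurable_env
  have hc := continuous_coeff_binomialKernel m
  set F : (({t} : Finset ℕ) → ℝ) → ℝ := fun x =>
    ∏ s ∈ S, PowerSeries.coeff (v s) (binomialKernel m (x ⟨t, Finset.mem_singleton_self t⟩))
  set G : ((T.image Prod.fst) → ℝ) → ℝ := fun x =>
    ∏ s ∈ T.attach, PowerSeries.coeff (v s.1)
      (binomialKernel m (x ⟨s.1.1, Finset.mem_image_of_mem _ s.2⟩))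
  have hF : Continuous F :=
    continuous_finsetProd _ fun s _ => (hc _).comp (continuous_apply _)
  have hG : Continuous G :=
    continuous_finsetProd _ fun s _ => (hc _).comp (continuous_apply _)
  have h := (hind.comp hF.measurable hG.measurable).integral_fun_mul_eq_mul_integral
    (hF.measurable.comp (measurable_pi_lambda _ fun _ => hX.measurable_env _)).aestronglyMeasurable
    (hG.measurable.comp (measurable_pi_lambda _ fun _ => hX.measurable_env _)).aestronglyMeasurable
  have e1 : ∀ ω, (F ∘ fun a (i : ({t} : Finset ℕ)) => env i a) ω =
      ∏ s ∈ S, PowerSeries.coeff (v s) (binomialKernel m (env s.1 ω)) := fun ω =>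
    Finset.prod_congr rfl fun s hs => by rw [hS s hs]
  have e2 : ∀ ω, (G ∘ fun a (i : (T.image Prod.fst : Finset ℕ)) => env i a) ω =
      ∏ s ∈ T, PowerSeries.coeff (v s) (binomialKernel m (env s.1 ω)) := fun ω =>
    Finset.prod_attach T fun s => PowerSeries.coeff (v s) (binomialKernel m (env s.1 ω))
  simp only [e1, e2] at h
  exact h

theorem measurable_process (t : ℕ) : Measurable (X t) := by
  induction t with
  | zero =>
    have : X 0 = fun _ => 1 := funext hX.start
    rw [this]; exact measurable_const
  | succ t ih =>
    have hp : Measurable fun p : ℕ × Ω => ∑ j ∈ Finset.range p.1, ξ t j p.2 :=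
      measurable_from_prod_countable_right fun k =>
        Finset.measurable_fun_sum (Finset.range k) fun j _ => hX.measurable_offspring t j
    have : X (t + 1) = fun ω => ∑ j ∈ Finset.range (X t ω), ξ t j ω := funext (hX.step t)
    rw [this]
    exact hp.comp (ih.prodMk measurable_id)

/-- Probability of `n` children of `k` individuals of the same generation. -/
theorem sum_measureReal_offspring (t k n : ℕ) :
    ∑ l ∈ Finset.finsuppAntidiag (Finset.range k) n,
      Pr.real {ω | ∀ s ∈ (Finset.range k).map (Function.Embedding.sectR t ℕ),
        ξ s.1 s.2 ω = l s.2} =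
      if k ≤ n ∧ n ≤ (m + 1) * k then 1 / ((m : ℝ) * k + 1) else 0 := by
  have hc := continuous_coeff_binomialKernel m
  have hlaw : ∀ f : ℝ → ℝ, Continuous f → ∫ ω, f (env t ω) ∂Pr = ∫ r, f r ∂uniformUnit := by
    intro f hf
    rw [← hX.law_env t, integral_map (hX.measurable_env t).aemeasurable
      hf.measurable.aestronglyMeasurable]
  rw [← integral_coeff_binomialKernel_pow]
  have hpow : ∀ r, PowerSeries.coeff n (binomialKernel m r ^ k) =
      ∑ l ∈ Finset.finsuppAntidiag (Finset.range k) n,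
        ∏ i ∈ Finset.range k, PowerSeries.coeff (l i) (binomialKernel m r) := fun r => by
    rw [← PowerSeries.coeff_prod, Finset.prod_const, Finset.card_range]
  simp only [hpow]
  rw [integral_finsetSum _ fun l _ => integrable_uniformUnit_of_continuous
    (continuous_finsetProd _ fun i _ => hc _)]
  refine Finset.sum_congr rfl fun l _ => ?_
  rw [hX.measureReal_offspring _ (fun s => l s.2)]
  simp only [Finset.prod_map, Function.Embedding.sectR_apply]
  exact hlaw _ (continuous_finsetProd _ fun i _ => hc _)

variable [IsProbabilityMeasure Pr]

/-- Splitting by the current size and the full offspring vector replaces the random-length sum by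
events about fixed individuals. The extra event `E` lets later reproduction be carried along. -/
theorem measureReal_succ_inter (t n : ℕ) {E : Set Ω} (hE : MeasurableSet E) :
    Pr.real ({ω | X (t + 1) ω = n} ∩ E) =
      ∑' k, ∑ l ∈ Finset.finsuppAntidiag (Finset.range k) n,
        Pr.real ({ω | X t ω = k} ∩ ({ω | ∀ s ∈ (Finset.range k).map
          (Function.Embedding.sectR t ℕ), ξ s.1 s.2 ω = l s.2} ∩ E)) := by
  have hm : ∀ t k, MeasurableSet {ω | X t ω = k} := fun t k =>
    hX.measurable_process t (measurableSet_singleton k)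
  have h1 : {ω | X (t + 1) ω = n} ∩ E =
      ⋃ k, {ω | X t ω = k} ∩ ({ω | X (t + 1) ω = n} ∩ E) := by
    ext ω; simp
  have h2 : ∀ k, {ω | X t ω = k} ∩ ({ω | X (t + 1) ω = n} ∩ E) =
      ⋃ l ∈ Finset.finsuppAntidiag (Finset.range k) n, {ω | X t ω = k} ∩
        ({ω | ∀ s ∈ (Finset.range k).map (Function.Embedding.sectR t ℕ), ξ s.1 s.2 ω = l s.2}
          ∩ E) := by
    intro k
    ext ω
    simp only [Set.mem_inter_iff, Set.mem_ofPred_eq, Finset.mem_finsuppAntidiag, Set.mem_iUnion,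
      Finset.mem_map, Function.Embedding.sectR_apply, forall_exists_index, and_imp,
      forall_apply_eq_imp_iff₂, exists_prop]
    constructor
    · rintro ⟨hk, hn, hEω⟩
      refine ⟨Finsupp.indicator (Finset.range k) fun j _ => ξ t j ω, ⟨?_, ?_⟩, hk, ?_, hEω⟩
      · rw [← hn, hX.step, hk]
        exact Finset.sum_congr rfl fun j hj => Finsupp.indicator_of_mem hj _
      · exact Finsupp.support_indicator_subset _ _
      · exact fun j hj => (Finsupp.indicator_of_mem hj fun j _ => ξ t j ω).symm
    · rintro ⟨l, ⟨hl, -⟩, hk, hξ, hEω⟩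
      refine ⟨hk, ?_, hEω⟩
      rw [hX.step, hk, ← hl]
      exact Finset.sum_congr rfl hξ
  have h3 : ∀ k, Pr.real ({ω | X t ω = k} ∩ ({ω | X (t + 1) ω = n} ∩ E)) =
      ∑ l ∈ Finset.finsuppAntidiag (Finset.range k) n, Pr.real ({ω | X t ω = k} ∩
        ({ω | ∀ s ∈ (Finset.range k).map (Function.Embedding.sectR t ℕ), ξ s.1 s.2 ω = l s.2}
          ∩ E)) := by
    intro k
    rw [h2, measureReal_biUnion_finset]
    · intro l hl l' hl' hne
      refine Set.disjoint_left.2 fun ω hω hω' => hne ?_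
      rw [Finset.mem_coe, Finset.mem_finsuppAntidiag] at hl hl'
      ext j
      by_cases hj : j ∈ Finset.range k
      · have hj' := Finset.mem_map_of_mem (Function.Embedding.sectR t ℕ) hj
        exact (hω.2.1 _ hj').symm.trans (hω'.2.1 _ hj')
      · rw [Finsupp.notMem_support_iff.1 fun h => hj (hl.2 h),
          Finsupp.notMem_support_iff.1 fun h => hj (hl'.2 h)]
    · exact fun l _ => (hm t k).inter ((hX.measurableSet_offspring _ fun s => l s.2).inter hE)
  simp only [← h3]
  rw [h1, measureReal_def, measure_iUnion, ENNReal.tsum_toReal_eq fun k => measure_ne_top _ _]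
  · congr 1
    funext k
    rw [← h1]
    rfl
  · intro k k' hne
    exact Set.disjoint_left.2 fun ω hω hω' => hne (hω.1.symm.trans hω'.1)
  · exact fun k => (hm t k).inter ((hm (t + 1) n).inter hE)

/-- The population at time `t` is independent of the reproduction from time `t` onwards. -/
theorem measureReal_process_inter_offspring (t k : ℕ) (S : Finset (ℕ × ℕ)) (v : ℕ × ℕ → ℕ)
    (hS : ∀ s ∈ S, t ≤ s.1) :
    Pr.real ({ω | X t ω = k} ∩ {ω | ∀ s ∈ S, ξ s.1 s.2 ω = v s}) =
      Pr.real {ω | X t ω = k} * Pr.real {ω | ∀ s ∈ S, ξ s.1 s.2 ω = v s} := by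
  classical
  induction t generalizing k S v with
  | zero =>
    by_cases h : k = 1
    · simp [hX.start, h]
    · simp [hX.start, Ne.symm h]
  | succ t ih =>
    have hu := hX.measureReal_succ_inter t k MeasurableSet.univ
    rw [Set.inter_univ] at hu
    rw [hX.measureReal_succ_inter t k (hX.measurableSet_offspring S v), hu, ← tsum_mul_right]
    congr 1
    funext i
    rw [Finset.sum_mul]
    refine Finset.sum_congr rfl fun l _ => ?_
    set R := (Finset.range i).map (Function.Embedding.sectR t ℕ)
    have hR : ∀ s ∈ R, s.1 = t := by simp [R]
    rw [Set.inter_univ, ih i R (fun s => l s.2) fun s hs => (hR s hs).ge]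
    -- Generation `t` and the later individuals of `S` are merged into one prescription, so that the
    -- induction hypothesis applies to `R ∪ S`.
    set v' : ℕ × ℕ → ℕ := fun s => if s ∈ R then l s.2 else v s
    have hSR : ∀ s ∈ S, s ∉ R := fun s hs hs' => by
      have := hS s hs; have := hR s hs'; omega
    have e1 : {ω | ∀ s ∈ R, ξ s.1 s.2 ω = l s.2} = {ω | ∀ s ∈ R, ξ s.1 s.2 ω = v' s} := by
      ext ω
      exact forall₂_congr fun s hs => by simp only [v', if_pos hs]
    have e2 : {ω | ∀ s ∈ S, ξ s.1 s.2 ω = v s} = {ω | ∀ s ∈ S, ξ s.1 s.2 ω = v' s} := by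
      ext ω
      exact forall₂_congr fun s hs => by simp only [v', if_neg (hSR s hs)]
    have e3 : {ω | ∀ s ∈ R, ξ s.1 s.2 ω = v' s} ∩ {ω | ∀ s ∈ S, ξ s.1 s.2 ω = v' s} =
        {ω | ∀ s ∈ R ∪ S, ξ s.1 s.2 ω = v' s} := by
      ext ω
      simp only [Set.mem_inter_iff, Set.mem_ofPred_eq, Finset.mem_union, or_imp, forall_and]
    rw [e1, e2, e3, ih i (R ∪ S) v', hX.measureReal_offspring_union t hR (fun s hs => hS s hs),
      mul_assoc]
    intro s hs
    rcases Finset.mem_union.1 hs with h | h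
    · exact (hR s h).ge
    · exact (Nat.le_succ t).trans (hS s h)

/-- The population size is a Markov chain that jumps from `k` to a uniformly chosen element of
`{k, …, (m + 1) k}`. -/
theorem measureReal_succ (t n : ℕ) :
    Pr.real {ω | X (t + 1) ω = n} =
      ∑ k ∈ Finset.range (n + 1), Pr.real {ω | X t ω = k} *
        if k ≤ n ∧ n ≤ (m + 1) * k then 1 / ((m : ℝ) * k + 1) else 0 := by
  have h := hX.measureReal_succ_inter t n MeasurableSet.univ
  rw [Set.inter_univ] at h
  rw [h, tsum_eq_sum (s := Finset.range (n + 1))]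
  · refine Finset.sum_congr rfl fun k _ => ?_
    rw [← hX.sum_measureReal_offspring t k n, Finset.mul_sum]
    refine Finset.sum_congr rfl fun l _ => ?_
    rw [Set.inter_univ, hX.measureReal_process_inter_offspring t k _ (fun s => l s.2)]
    simp
  · intro k hk
    -- For `k > n` the offspring vectors themselves have total probability zero.
    have hs := hX.sum_measureReal_offspring t k n
    rw [if_neg (by simp at hk; omega)] at hs
    rw [Finset.sum_eq_zero_iff_of_nonneg fun _ _ => measureReal_nonneg] at hs
    refine Finset.sum_eq_zero fun l hl => le_antisymm ?_ measureReal_nonneg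
    rw [← hs l hl, Set.inter_univ]
    exact measureReal_mono Set.inter_subset_right

theorem measureReal_succ_eq_sum_Ioc (t : ℕ) {n : ℕ} (hn : 1 ≤ n) :
    Pr.real {ω | X (t + 1) ω = n} =
      ∑ k ∈ Finset.Ioc ((n - 1) / (m + 1)) n, Pr.real {ω | X t ω = k} / ((m : ℝ) * k + 1) := by
  rw [hX.measureReal_succ]
  have hsub : Finset.Ioc ((n - 1) / (m + 1)) n ⊆ Finset.range (n + 1) := fun k hk => by
    rw [Finset.mem_Ioc] at hk; rw [Finset.mem_range]; omega
  rw [← Finset.sum_subset hsub]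
  · refine Finset.sum_congr rfl fun k hk => ?_
    rw [Finset.mem_Ioc, Nat.div_lt_iff_lt_mul (by omega)] at hk
    rw [if_pos ⟨hk.2, by rw [mul_comm]; omega⟩, mul_one_div]
  · intro k hk hk'
    rw [Finset.mem_Ioc, Nat.div_lt_iff_lt_mul (by omega)] at hk'
    rw [Finset.mem_range] at hk
    rw [if_neg, mul_zero]
    rintro ⟨h1, h2⟩
    rw [mul_comm] at h2
    exact hk' ⟨by omega, h1⟩

theorem measureReal_eq_one (t : ℕ) : Pr.real {ω | X t ω = 1} = (1 / ((m : ℝ) + 1)) ^ t := by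
  induction t with
  | zero => simp [hX.start]
  | succ t ih =>
    rw [hX.measureReal_succ_eq_sum_Ioc t le_rfl]
    simp [ih, pow_succ, div_eq_mul_inv]

end IsGaltonWatsonInRandomEnvironment

end BranchingProcess

/-! ### The recursion for the limiting ratios. -/

theorem sum_window_succ (f : ℕ → ℝ) (m N : ℕ) :
    ∑ k ∈ Finset.Ioc ((N + 1) / (m + 1)) (N + 1), f k =
      ∑ k ∈ Finset.Ioc (N / (m + 1)) N, f k + f (N + 1)
        - if (m + 1) ∣ (N + 1) then f ((N + 1) / (m + 1)) else 0 := by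
  have hq : N / (m + 1) ≤ N := Nat.div_le_self _ _
  rw [← Finset.sum_Ioc_succ_top hq]
  rw [Nat.succ_div]
  split_ifs with h
  · rw [← Finset.sum_Ioc_consecutive f (Nat.le_succ (N / (m + 1))) (Nat.succ_le_succ hq)]
    simp
  · simp

section Recursion

variable {m : ℕ} {φ : ℕ → ℝ}

theorem exists_tendsto_of_linear_recursion {x : ℕ → ℕ → ℝ} (hx1 : ∀ t, x t 1 = 1)
    (hm : 1 ≤ m)
    (hx : ∀ t n, 1 ≤ n → x (t + 1) n =
      (m + 1) * ∑ k ∈ Finset.Ioc ((n - 1) / (m + 1)) n, x t k / ((m : ℝ) * k + 1)) (n : ℕ)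
    (hn : 1 ≤ n) : ∃ l, Tendsto (fun t => x t n) atTop (𝓝 l) := by
  induction n using Nat.strong_induction_on with
  | _ n ih =>
    rcases Nat.eq_or_lt_of_le hn with rfl | hn2
    · exact ⟨1, by simp [hx1]⟩
    obtain ⟨i, rfl⟩ : ∃ i, n = i + 1 := ⟨n - 1, by omega⟩
    have hlim : ∃ b, Tendsto (fun t => ((m : ℝ) + 1) *
        ∑ k ∈ Finset.Ioc (i / (m + 1)) i, x t k / ((m : ℝ) * k + 1)) atTop (𝓝 b) := by
      have : ∀ k ∈ Finset.Ioc (i / (m + 1)) i, ∃ l, Tendsto (fun t => x t k) atTop (𝓝 l) :=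
        fun k hk => by
          rw [Finset.mem_Ioc] at hk
          exact ih k (by omega) (Nat.pos_of_ne_zero (Nat.ne_zero_of_lt hk.1))
      choose! l hl using this
      exact ⟨_, (tendsto_finsetSum _ fun k hk => (hl k hk).div_const _).const_mul _⟩
    obtain ⟨b, hb⟩ := hlim
    set β : ℕ → ℝ := fun t => ((m : ℝ) + 1) *
      ∑ k ∈ Finset.Ioc (i / (m + 1)) i, x t k / ((m : ℝ) * k + 1)
    -- The diagonal coefficient of the recursion at `n = i + 1`; it is below 1 exactly because `i ≥
    -- 1`.
    set c : ℝ := (m + 1) / ((m : ℝ) * (i + 1 : ℕ) + 1) with hc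
    have hm' : (1 : ℝ) ≤ m := by exact_mod_cast hm
    have hi : (1 : ℝ) ≤ i := by exact_mod_cast (by omega : 1 ≤ i)
    have hc0 : 0 ≤ c := by positivity
    have hc1 : c < 1 := by
      rw [hc, div_lt_one (by positivity)]; push_cast; nlinarith
    have hrec : ∀ t, x (t + 1) (i + 1) = c * x t (i + 1) + β t := by
      intro t
      rw [hx t _ hn, Nat.add_sub_cancel, Finset.sum_Ioc_succ_top (Nat.div_le_self _ _)]
      simp only [β, hc]
      ring
    have h1c : 1 - c ≠ 0 := by linarith
    refine ⟨b / (1 - c), ?_⟩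
    rw [tendsto_iff_norm_sub_tendsto_zero]
    have hρ : Tendsto (fun t => ‖β t - b‖) atTop (𝓝 0) := tendsto_iff_norm_sub_tendsto_zero.1 hb
    refine tendsto_zero_of_window_contraction hc0 hc1 (fun _ => norm_nonneg _) tendsto_id hρ
      (.of_forall fun t B _ hB => ?_)
    have h := hB t le_rfl le_rfl
    have e : x (t + 1) (i + 1) - b / (1 - c) =
        c * (x t (i + 1) - b / (1 - c)) + (β t - b) := by
      rw [hrec]; field_simp; ring
    rw [e]
    refine (norm_add_le _ _).trans (add_le_add_left ?_ _)
    rw [norm_mul, Real.norm_of_nonneg hc0]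
    gcongr

variable (hm : 1 ≤ m) (hφ1 : φ 1 = 1)
  (hφ : ∀ n, 1 ≤ n →
    φ n = (m + 1) * ∑ k ∈ Finset.Ioc ((n - 1) / (m + 1)) n, φ k / ((m : ℝ) * k + 1))
include hφ

theorem mul_eq_sum_window (N : ℕ) :
    m * N * (φ (N + 1) / ((m : ℝ) * (N + 1 : ℕ) + 1)) =
      (m + 1) * ∑ k ∈ Finset.Ioc (N / (m + 1)) N, φ k / ((m : ℝ) * k + 1) := by
  have h := hφ (N + 1) (by omega)
  rw [Nat.add_sub_cancel, Finset.sum_Ioc_succ_top (Nat.div_le_self _ _)] at h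
  have hpos : (m : ℝ) * (N + 1 : ℕ) + 1 ≠ 0 := by positivity
  have h2 : φ (N + 1) = (φ (N + 1) / ((m : ℝ) * (N + 1 : ℕ) + 1)) * ((m : ℝ) * (N + 1 : ℕ) + 1) :=
    (div_mul_cancel₀ _ hpos).symm
  generalize φ (N + 1) / ((m : ℝ) * (N + 1 : ℕ) + 1) = g at *
  push_cast at h2
  linarith

include hm hφ1

/-- A first integral of `mul_eq_sum_window`: moving the window changes both sides equally. A term
`j` leaves only when `N + 1 = (m + 1) * j`, and then the weights `m + 1` and `(N + 1) / j` agree.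
The constant is the value at `N = 0`. -/
theorem eq_add_sum_window_div (N : ℕ) :
    φ (N + 1) / ((m : ℝ) * (N + 1 : ℕ) + 1) = 1 / ((m : ℝ) + 1) +
      1 / m * ∑ k ∈ Finset.Ioc (N / (m + 1)) N, φ k / ((m : ℝ) * k + 1) / k := by
  have hm0 : (m : ℝ) ≠ 0 := by positivity
  induction N with
  | zero => simp [hφ1]
  | succ N ih =>
    have h1 := mul_eq_sum_window hφ N
    have h2 := mul_eq_sum_window hφ (N + 1)
    rw [sum_window_succ] at h2 ⊢
    set g : ℕ → ℝ := fun k => φ k / ((m : ℝ) * k + 1) with hg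
    change g (N + 1) = 1 / ((m : ℝ) + 1) + 1 / m * ∑ k ∈ Finset.Ioc (N / (m + 1)) N, g k / k at ih
    change m * N * g (N + 1) = (m + 1) * ∑ k ∈ Finset.Ioc (N / (m + 1)) N, g k at h1
    change m * (N + 1 : ℕ) * g (N + 1 + 1) =
      (m + 1) * (∑ k ∈ Finset.Ioc (N / (m + 1)) N, g k + g (N + 1) -
        if (m + 1) ∣ (N + 1) then g ((N + 1) / (m + 1)) else 0) at h2
    change g (N + 1 + 1) = 1 / ((m : ℝ) + 1) +
      1 / m * (∑ k ∈ Finset.Ioc (N / (m + 1)) N, g k / k + g (N + 1) / (N + 1 : ℕ) -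
        if (m + 1) ∣ (N + 1) then g ((N + 1) / (m + 1)) / ((N + 1) / (m + 1) : ℕ) else 0)
    rw [mul_sub, mul_add, ← add_sub_assoc, ← add_assoc, ← ih]
    rw [mul_sub, mul_add, ← h1] at h2
    have hN : ((N + 1 : ℕ) : ℝ) ≠ 0 := by positivity
    have hN' : ((N + 1 : ℕ) : ℝ) = N + 1 := by push_cast; rfl
    apply mul_left_cancel₀ (mul_ne_zero hm0 hN)
    rw [h2]
    split_ifs with hdvd
    · obtain ⟨j, hj⟩ := hdvd
      rw [hj, Nat.mul_div_cancel_left _ (Nat.succ_pos m), ← hj]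
      have hj0 : (j : ℝ) ≠ 0 := by
        rintro h0
        have : j = 0 := by exact_mod_cast h0
        subst this; omega
      have hj' : ((N + 1 : ℕ) : ℝ) = (m + 1) * j := by rw [hj]; push_cast; rfl
      have e1 : (m : ℝ) * (N + 1 : ℕ) * (1 / m * (g (N + 1) / (N + 1 : ℕ))) = g (N + 1) := by
        field_simp
      have e2 : (m : ℝ) * (N + 1 : ℕ) * (1 / m * (g j / j)) = (m + 1) * g j := by
        rw [hj']; field_simp
      rw [mul_sub, mul_add, e1, e2, hN']
      ring
    · have e1 : (m : ℝ) * (N + 1 : ℕ) * (1 / m * (g (N + 1) / (N + 1 : ℕ))) = g (N + 1) := by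
        field_simp
      rw [mul_zero, mul_zero, sub_zero, sub_zero, mul_add, e1, hN']
      ring

/-- Obtained as `(m + 1) / m` times `N` times `eq_add_sum_window_div`, minus `mul_eq_sum_window`
divided by `m²`. The weight now vanishes at `k = N`, which makes the recursion contract at second
order. -/
theorem mul_eq_add_weighted_sum_window (N : ℕ) :
    N * (φ (N + 1) / ((m : ℝ) * (N + 1 : ℕ) + 1)) = N / m + (m + 1) / (m : ℝ) ^ 2 *
      ∑ k ∈ Finset.Ioc (N / (m + 1)) N, ((N : ℝ) / k - 1) * (φ k / ((m : ℝ) * k + 1)) := by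
  have hm0 : (m : ℝ) ≠ 0 := by positivity
  have h1 := mul_eq_sum_window hφ N
  have h2 := eq_add_sum_window_div hm hφ1 hφ N
  have e : ∑ k ∈ Finset.Ioc (N / (m + 1)) N, ((N : ℝ) / k - 1) * (φ k / ((m : ℝ) * k + 1)) =
      N * ∑ k ∈ Finset.Ioc (N / (m + 1)) N, φ k / ((m : ℝ) * k + 1) / k -
        ∑ k ∈ Finset.Ioc (N / (m + 1)) N, φ k / ((m : ℝ) * k + 1) := by
    rw [Finset.mul_sum, ← Finset.sum_sub_distrib]
    exact Finset.sum_congr rfl fun k _ => by ring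
  rw [e]
  generalize φ (N + 1) / ((m : ℝ) * (N + 1 : ℕ) + 1) = g at *
  generalize ∑ k ∈ Finset.Ioc (N / (m + 1)) N, φ k / ((m : ℝ) * k + 1) / k = S at *
  generalize ∑ k ∈ Finset.Ioc (N / (m + 1)) N, φ k / ((m : ℝ) * k + 1) = T at *
  field_simp at h2 ⊢
  linear_combination (N : ℝ) * h2 - h1

end Recursion

/-! ### Second-order asymptotics. -/

theorem sum_window_sub_one (m N : ℕ) :
    ∑ k ∈ Finset.Ioc (N / (m + 1)) N, ((N : ℝ) / k - 1) =
      N * ∑ k ∈ Finset.Ioc (N / (m + 1)) N, (k : ℝ)⁻¹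
        - (m * N + (N % (m + 1) : ℕ)) / (m + 1) := by
  have hN : (N : ℝ) = (m + 1) * (N / (m + 1) : ℕ) + (N % (m + 1) : ℕ) := by
    exact_mod_cast (Nat.div_add_mod N (m + 1)).symm
  have hm1 : (m : ℝ) + 1 ≠ 0 := by positivity
  rw [Finset.sum_sub_distrib, Finset.mul_sum]
  simp only [Finset.sum_const, Nat.card_Ioc, nsmul_eq_mul, mul_one, ← div_eq_mul_inv]
  rw [Nat.cast_sub (Nat.div_le_self _ _)]
  congr 1
  rw [eq_div_iff hm1]
  linear_combination hN

/-- The periodic second order term of the limiting ratios, shifted by `1 / m`. -/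
noncomputable def limitOscillation (m : ℕ) (k : ℕ) : ℝ :=
  -(m : ℝ) / (2 * ((m + 1) * Real.log (m + 1) - m)) - 1 / 2 + ((k - 1) % (m + 1) : ℕ) / m

section Asymptotics

variable {m : ℕ} {φ : ℕ → ℝ} (hm : 1 ≤ m)
include hm

theorem log_succ_lt : Real.log (m + 1) < m := by
  have hm' : (1 : ℝ) ≤ m := by exact_mod_cast hm
  have := Real.log_lt_sub_one_of_pos (show (0 : ℝ) < m + 1 by positivity) (by linarith)
  linarith

theorem lt_mul_log_succ : (m : ℝ) < (m + 1) * Real.log (m + 1) := by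
  have hm' : (1 : ℝ) ≤ m := by exact_mod_cast hm
  have h := Real.log_lt_sub_one_of_pos (show (0 : ℝ) < (m + 1 : ℝ)⁻¹ by positivity)
    (by rw [ne_eq, inv_eq_one]; linarith)
  rw [Real.log_inv] at h
  have h2 : ((m : ℝ) + 1) * (m + 1 : ℝ)⁻¹ = 1 := mul_inv_cancel₀ (by positivity)
  nlinarith

theorem abs_oscillation_le (k : ℕ) : |limitOscillation m k| ≤
    |-(m : ℝ) / (2 * ((m + 1) * Real.log (m + 1) - m)) - 1 / 2| + 1 := by
  have hm' : (0 : ℝ) < m := by exact_mod_cast hm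
  refine (abs_add_le _ _).trans (add_le_add_right ?_ _)
  rw [abs_of_nonneg (by positivity), div_le_one hm']
  exact_mod_cast Nat.lt_succ_iff.1 (Nat.mod_lt _ (Nat.succ_pos m))

theorem tendsto_sub_oscillation (hφ1 : φ 1 = 1)
    (hφ : ∀ n, 1 ≤ n →
      φ n = (m + 1) * ∑ k ∈ Finset.Ioc ((n - 1) / (m + 1)) n, φ k / ((m : ℝ) * k + 1)) {c : ℝ}
    (hc : c = m / ((m + 1) * (m - Real.log (m + 1)))) :
    Tendsto (fun k : ℕ => k * (φ k / ((m : ℝ) * k + 1) - c) - c * limitOscillation m k) atTop (𝓝 0) := by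
  have hL1 := log_succ_lt hm
  have hL2 := lt_mul_log_succ hm
  have hm' : (0 : ℝ) < m := by exact_mod_cast hm
  set L := Real.log (m + 1) with hL
  set K : ℝ := (m + 1) / (m : ℝ) ^ 2 with hK
  have hK0 : 0 < K := by positivity
  set κ : ℝ := K * (m - L) with hκ
  have hκ0 : 0 ≤ κ := mul_nonneg hK0.le (by linarith)
  have hκ1 : κ < 1 := by
    rw [hκ, hK, div_mul_eq_mul_div, div_lt_one (by positivity)]; nlinarith
  set θ : ℝ := -(m : ℝ) / (2 * ((m + 1) * L - m)) with hθ
  have hD : ((m : ℝ) + 1) * L - m ≠ 0 := by linarith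
  have hE : (m : ℝ) - L ≠ 0 := by linarith
  -- `θ` is the mean of `limitOscillation` over a period; this equation determines it.
  have hθκ : θ = -1 / (2 * m) + κ * θ := by
    rw [hθ, hκ, hK]; field_simp; ring
  set g : ℕ → ℝ := fun k => φ k / ((m : ℝ) * k + 1) with hg
  set e : ℕ → ℝ := fun k => k * (g k - c) - c * limitOscillation m k with he
  set W : ℕ → Finset ℕ := fun N => Finset.Ioc (N / (m + 1)) N with hW
  set w : ℕ → ℕ → ℝ := fun N k => ((N : ℝ) / k - 1) / k with hw
  -- The source collects the errors in the harmonic sum, the total weight, the averaged oscillation,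
  -- and the replacement of `N + 1` by `N`.
  set ρ : ℕ → ℝ := fun N =>
    c * K * (N * ∑ k ∈ W N, (k : ℝ)⁻¹ - (N * L + (N % (m + 1) : ℕ) - m / 2))
    + c * θ * (K * ∑ k ∈ W N, w N k - κ)
    + c * K / m * ∑ k ∈ W N, w N k * ((((k - 1) % (m + 1) : ℕ) : ℝ) - m / 2)
    + c * limitOscillation m (N + 1) / ((N : ℝ) + 1) with hρdef
  have hsumw : Tendsto (fun N => K * ∑ k ∈ W N, w N k) atTop (𝓝 κ) :=
    (tendsto_sum_window_weight m).const_mul K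
  have hρ : Tendsto ρ atTop (𝓝 0) := by
    have h1 := (tendsto_mul_sum_inv_window m).const_mul (c * K)
    have h2 := (hsumw.sub_const κ).const_mul (c * θ)
    have h3 := (tendsto_sum_window_weight_mul_mod m).const_mul (c * K / m)
    have h4 : Tendsto (fun N : ℕ => c * limitOscillation m (N + 1) / ((N : ℝ) + 1)) atTop (𝓝 0) := by
      refine squeeze_zero_norm (fun N => ?_) ((tendsto_one_div_add_atTop_nhds_zero_nat
        (𝕜 := ℝ)).const_mul (|c| * (|θ - 1 / 2| + 1)) |>.trans (by rw [mul_zero]))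
      rw [norm_div, norm_mul, Real.norm_eq_abs, Real.norm_eq_abs,
        Real.norm_of_nonneg (by positivity), mul_one_div]
      gcongr
      exact abs_oscillation_le hm _
    simpa using ((h1.add h2).add h3).add h4
  have hrec : ∀ N : ℕ, (N : ℝ) / (N + 1) * e (N + 1) = K * ∑ k ∈ W N, w N k * e k + ρ N := by
    intro N
    have h := mul_eq_add_weighted_sum_window hm hφ1 hφ N
    have e1 : ∑ k ∈ W N, ((N : ℝ) / k - 1) * g k = c * ∑ k ∈ W N, ((N : ℝ) / k - 1) +
        ∑ k ∈ W N, w N k * e k + c * θ * ∑ k ∈ W N, w N k +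
        c / m * ∑ k ∈ W N, w N k * ((((k - 1) % (m + 1) : ℕ) : ℝ) - m / 2) := by
      simp only [Finset.mul_sum, ← Finset.sum_add_distrib]
      refine Finset.sum_congr rfl fun k hk => ?_
      have hk0 : (k : ℝ) ≠ 0 := by exact_mod_cast Nat.ne_zero_of_lt (Finset.mem_Ioc.1 hk).1
      simp only [hw, he, limitOscillation, ← hL, ← hθ]
      field_simp
      ring
    change N * g (N + 1) = N / m + K * ∑ k ∈ W N, ((N : ℝ) / k - 1) * g k at h
    rw [e1, sum_window_sub_one] at h
    change N * g (N + 1) = N / m + K * (c * (N * ∑ k ∈ W N, (k : ℝ)⁻¹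
        - (m * N + (N % (m + 1) : ℕ)) / (m + 1)) + _ + _ + _) at h
    have e2 : (N : ℝ) / (N + 1) * e (N + 1) = N * g (N + 1) - N * c
        - c * limitOscillation m (N + 1) + c * limitOscillation m (N + 1) / (N + 1) := by
      simp only [he]; push_cast; field_simp; ring
    have e3 : limitOscillation m (N + 1) = θ - 1 / 2 + (N % (m + 1) : ℕ) / m := by
      simp only [limitOscillation, ← hL, ← hθ, Nat.add_sub_cancel]
    rw [e2, h]
    simp only [hρdef]
    nth_rewrite 1 [e3]
    generalize ∑ k ∈ W N, (k : ℝ)⁻¹ = S1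
    generalize ∑ k ∈ W N, w N k * e k = S2
    generalize ∑ k ∈ W N, w N k * ((((k - 1) % (m + 1) : ℕ) : ℝ) - m / 2) = S3
    generalize ∑ k ∈ W N, w N k = S4
    generalize ((N % (m + 1) : ℕ) : ℝ) = s
    -- Terms linear in `N` match by the choice of `c`, those in `s` since `K - K / (m + 1) = 1 / m`,
    -- and the constants by `hθκ`.
    have e4 : (N : ℝ) / m - N * c + K * (c * (-(m * N + s) / (m + 1))) - c * (θ - 1 / 2 + s / m) =
        -(c * K * (N * L + s - m / 2)) - c * θ * κ := by
      have e5 : (N : ℝ) / m - N * c - c * K * (m * N / (m + 1)) + c * K * (N * L) = 0 := by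
        rw [hc, hK]; field_simp; ring
      have e7 : K / (m + 1) = 1 / m ^ 2 := by rw [hK]; field_simp
      have e8 : K = 1 / m + 1 / m ^ 2 := by rw [hK]; field_simp
      have e9 : K * (m / 2) = 1 / 2 + 1 / (2 * m) := by rw [hK]; field_simp
      have e10 : K * (c * (-(m * N + s) / (m + 1))) =
        - (c * K * (m * N / (m + 1))) - c * s * (K / (m + 1)) := by field_simp; ring
      have e11 : (-1 : ℝ) / (2 * m) = - (1 / (2 * m)) := by ring
      rw [e11] at hθκ
      rw [e10, e7]
      linear_combination e5 - c * hθκ + c * e9 * (-1) + c * s * e8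
    linear_combination e4
  have habs : Tendsto (fun N => ‖e N‖) atTop (𝓝 0) := by
    have hq : Tendsto (fun N : ℕ => (((N : ℝ) + 1) / N) * (K * ∑ k ∈ W N, w N k)) atTop (𝓝 κ) := by
      have h1 : Tendsto (fun N : ℕ => ((N : ℝ) + 1) / N) atTop (𝓝 1) := by
        have h2 := (tendsto_one_div_atTop_nhds_zero_nat (𝕜 := ℝ)).const_add 1
        rw [add_zero] at h2
        refine h2.congr' ?_
        filter_upwards [eventually_ge_atTop 1] with N hN
        have : (N : ℝ) ≠ 0 := by positivity
        field_simp
      simpa using h1.mul hsumw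
    have hρ2 : Tendsto (fun N => 2 * ‖ρ N‖) atTop (𝓝 0) := by
      simpa using hρ.norm.const_mul 2
    -- The midpoint between `κ` and 1 absorbs the factor `(N + 1) / N` and the finite-`N` error in
    -- the weights.
    refine tendsto_zero_of_window_contraction (κ := (κ + 1) / 2) (lo := fun N => N / (m + 1))
      (by linarith) (by linarith) (fun _ => norm_nonneg _)
      (Nat.tendsto_div_const_atTop (by omega)) hρ2 ?_
    filter_upwards [hq.eventually (ge_mem_nhds (show κ < (κ + 1) / 2 by linarith)),
      eventually_ge_atTop 1] with N hN hN1 B hB0 hB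
    have hN0 : (1 : ℝ) ≤ N := by exact_mod_cast hN1
    have h1 : e (N + 1) = ((N : ℝ) + 1) / N * (K * ∑ k ∈ W N, w N k * e k + ρ N) := by
      rw [← hrec]; field_simp
    have h2 : ‖∑ k ∈ W N, w N k * e k‖ ≤ (∑ k ∈ W N, w N k) * B := by
      rw [Finset.sum_mul]
      refine (norm_sum_le _ _).trans (Finset.sum_le_sum fun k hk => ?_)
      obtain ⟨hk1, hk2⟩ := Finset.mem_Ioc.1 hk
      have hk0 : (0 : ℝ) < k := by exact_mod_cast Nat.pos_of_ne_zero (Nat.ne_zero_of_lt hk1)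
      have hw0 : 0 ≤ w N k := by
        refine div_nonneg ?_ hk0.le
        rw [sub_nonneg, one_le_div hk0]
        exact_mod_cast hk2
      rw [norm_mul, Real.norm_of_nonneg hw0]
      exact mul_le_mul_of_nonneg_left (hB k hk1.le hk2) hw0
    have hr : ((N : ℝ) + 1) / N ≤ 2 := by rw [div_le_iff₀ (by linarith)]; linarith
    have hr0 : 0 ≤ ((N : ℝ) + 1) / N := by positivity
    have h3 : ‖K * ∑ k ∈ W N, w N k * e k + ρ N‖ ≤ K * ((∑ k ∈ W N, w N k) * B) + ‖ρ N‖ := by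
      refine (norm_add_le _ _).trans (add_le_add_left ?_ _)
      rw [norm_mul, Real.norm_of_nonneg hK0.le]
      exact mul_le_mul_of_nonneg_left h2 hK0.le
    rw [h1, norm_mul, Real.norm_of_nonneg hr0]
    calc ((N : ℝ) + 1) / N * ‖K * ∑ k ∈ W N, w N k * e k + ρ N‖
        ≤ ((N : ℝ) + 1) / N * (K * ((∑ k ∈ W N, w N k) * B) + ‖ρ N‖) := by gcongr
      _ = ((N : ℝ) + 1) / N * (K * ∑ k ∈ W N, w N k) * B + ((N : ℝ) + 1) / N * ‖ρ N‖ := by ring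
      _ ≤ (κ + 1) / 2 * B + 2 * ‖ρ N‖ := by gcongr
  exact tendsto_zero_iff_norm_tendsto_zero.2 habs

theorem oscillation_add_period {n : ℕ} (hn : 1 ≤ n) :
    limitOscillation m (n + (m + 1)) = limitOscillation m n := by
  have : n + (m + 1) - 1 = n - 1 + (m + 1) := by omega
  rw [limitOscillation, limitOscillation, this, Nat.add_mod_right]

theorem oscillation_eq_ite {n : ℕ} (hn : 2 ≤ n) :
    limitOscillation m n = if (m + 1) ∣ (n - 1) then limitOscillation m (n - 1) - 1
      else limitOscillation m (n - 1) + 1 / m := by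
  have hm0 : (m : ℝ) ≠ 0 := by positivity
  obtain ⟨i, rfl⟩ : ∃ i, n = i + 2 := ⟨n - 2, by omega⟩
  have e : i + 2 - 1 = i + 1 := rfl
  have hlt : i % (m + 1) < m + 1 := Nat.mod_lt i (Nat.succ_pos m)
  have h := Nat.add_mod_eq_ite (m := i) (n := 1) (k := m + 1)
  rw [Nat.mod_eq_of_lt (show 1 < m + 1 by omega)] at h
  simp only [limitOscillation, e, Nat.add_sub_cancel, Nat.dvd_iff_mod_eq_zero]
  split_ifs at h with h1
  · have h2 : i % (m + 1) = m := by omega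
    have h3 : (i + 1) % (m + 1) = 0 := by omega
    rw [if_pos h3, h3, h2, div_self hm0]
    simp
  · rw [if_neg (by omega), h]
    push_cast
    ring

theorem oscillation_period :
    limitOscillation m (m + 1) + 1 / m = ((m : ℝ) + 1) / (2 * m) *
      ((((m : ℝ) + 2) * Real.log (m + 1) - 2 * m) / (((m : ℝ) + 1) * Real.log (m + 1) - m)) := by
  have hL2 := lt_mul_log_succ hm
  have hD : ((m : ℝ) + 1) * Real.log (m + 1) - m ≠ 0 := by linarith
  have hm0 : (m : ℝ) ≠ 0 := by positivity
  rw [limitOscillation, Nat.add_sub_cancel, Nat.mod_eq_of_lt (Nat.lt_succ_self m), div_self hm0]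
  field_simp
  ring

end Asymptotics

/-! ### Conclusion. -/

theorem theorem2 {Ω : Type*} [MeasurableSpace Ω] (Pr : Measure Ω) [IsProbabilityMeasure Pr]
    (m : ℕ) (hm : 1 ≤ m)
    (env : ℕ → Ω → ℝ) (ξ : ℕ → ℕ → Ω → ℕ) (X : ℕ → Ω → ℕ)
    (hX : IsGaltonWatsonInRandomEnvironment Pr uniformUnit (binomialKernel m) env ξ X) :
    (∀ t : ℕ, 0 < Pr.real {ω | X t ω = 1}) ∧
    ∃ φ ψ : ℕ → ℝ,
      (∀ n : ℕ, 1 ≤ n →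
        Tendsto (fun t : ℕ => Pr.real {ω | X t ω = n} / Pr.real {ω | X t ω = 1}) atTop
          (𝓝 (φ n))) ∧
      (∀ n : ℕ, 2 ≤ n →
        ψ n = if (m + 1) ∣ (n - 1) then ψ (n - 1) - 1 else ψ (n - 1) + 1 / (m : ℝ)) ∧
      ψ (m + 1) = ((m : ℝ) + 1) / (2 * m) *
        ((((m : ℝ) + 2) * Real.log (m + 1) - 2 * m) /
          (((m : ℝ) + 1) * Real.log (m + 1) - m)) ∧
      (∀ n : ℕ, 1 ≤ n → ψ (n + (m + 1)) = ψ n) ∧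
      ∃ ε : ℕ → ℝ, Tendsto ε atTop (𝓝 0) ∧
        ∀ n : ℕ, 1 ≤ n →
          φ n = (m : ℝ) ^ 2 / (((m : ℝ) + 1) * (m - Real.log (m + 1))) * (n + ψ n + ε n) := by
  have hpos : ∀ t : ℕ, 0 < Pr.real {ω | X t ω = 1} := fun t => by
    rw [hX.measureReal_eq_one]; positivity
  refine ⟨hpos, ?_⟩
  set x : ℕ → ℕ → ℝ := fun t n => Pr.real {ω | X t ω = n} / Pr.real {ω | X t ω = 1} with hxdef
  have hx1 : ∀ t, x t 1 = 1 := fun t => div_self (hpos t).ne'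
  have hx : ∀ t n, 1 ≤ n → x (t + 1) n =
      (m + 1) * ∑ k ∈ Finset.Ioc ((n - 1) / (m + 1)) n, x t k / ((m : ℝ) * k + 1) := by
    intro t n hn
    have h1 : Pr.real {ω | X (t + 1) ω = 1} = Pr.real {ω | X t ω = 1} / (m + 1) := by
      rw [hX.measureReal_eq_one, hX.measureReal_eq_one, pow_succ, mul_one_div]
    have h0 := (hpos t).ne'
    simp only [hxdef]
    rw [hX.measureReal_succ_eq_sum_Ioc t hn, h1, Finset.mul_sum, Finset.sum_div]
    refine Finset.sum_congr rfl fun k _ => ?_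
    field_simp
  have hlim := exists_tendsto_of_linear_recursion hx1 hm hx
  choose! φ hφlim using hlim
  have hφ1 : φ 1 = 1 := by
    refine tendsto_nhds_unique (hφlim 1 le_rfl) ?_
    simp only [hx1]
    exact tendsto_const_nhds
  have hφ : ∀ n, 1 ≤ n →
      φ n = (m + 1) * ∑ k ∈ Finset.Ioc ((n - 1) / (m + 1)) n, φ k / ((m : ℝ) * k + 1) := by
    intro n hn
    refine tendsto_nhds_unique ((hφlim n hn).comp (tendsto_add_atTop_nat 1)) ?_
    have : (fun t => x t n) ∘ (fun t => t + 1) = fun t =>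
      ((m : ℝ) + 1) * ∑ k ∈ Finset.Ioc ((n - 1) / (m + 1)) n, x t k / ((m : ℝ) * k + 1) :=
      funext fun t => hx t n hn
    rw [this]
    refine (tendsto_finsetSum _ fun k hk => (hφlim k ?_).div_const _).const_mul _
    exact Nat.pos_of_ne_zero (Nat.ne_zero_of_lt (Finset.mem_Ioc.1 hk).1)
  have hm' : (0 : ℝ) < m := by exact_mod_cast hm
  have hL1 : 0 < (m : ℝ) - Real.log (m + 1) := sub_pos.2 (log_succ_lt hm)
  set c : ℝ := m / ((m + 1) * (m - Real.log (m + 1))) with hc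
  have hc0 : 0 < c := by positivity
  have hmain := tendsto_sub_oscillation hm hφ1 hφ hc
  have hC : (m : ℝ) ^ 2 / (((m : ℝ) + 1) * (m - Real.log (m + 1))) = m * c := by
    rw [hc]; ring
  -- The shift `1 / m` comes from `φ n = (m * n + 1) * g n = m (n + 1 / m) g n`.
  refine ⟨φ, fun n => limitOscillation m n + 1 / m, hφlim, fun n hn => ?_, oscillation_period hm,
    fun n hn => by simp only [oscillation_add_period hm hn],
    fun n => φ n / (m * c) - n - (limitOscillation m n + 1 / m), ?_, fun n hn => ?_⟩
  · simp only [oscillation_eq_ite hm hn]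
    split_ifs <;> ring
  · set e : ℕ → ℝ := fun k : ℕ => k * (φ k / ((m : ℝ) * k + 1) - c) - c * limitOscillation m k with he
    have h1 : Tendsto (fun n : ℕ => limitOscillation m n * (1 / (n : ℝ))) atTop (𝓝 0) :=
      isBoundedUnder_le_mul_tendsto_zero ⟨_, eventually_map.2
        (.of_forall fun k => abs_oscillation_le hm k)⟩ tendsto_one_div_atTop_nhds_zero_nat
    -- For `n ≥ 1`, `ε n = e n / c + e n / (n m c) + limitOscillation m n / (n m)`.
    have h2 := ((hmain.div_const c).add ((hmain.mul
      (tendsto_one_div_atTop_nhds_zero_nat (𝕜 := ℝ))).div_const (m * c))).add (h1.div_const m)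
    simp only [mul_zero, zero_div, add_zero] at h2
    refine h2.congr' ?_
    filter_upwards [eventually_ge_atTop 1] with n hn
    have hn0 : (n : ℝ) ≠ 0 := by positivity
    have hmn : (m : ℝ) * n + 1 ≠ 0 := by positivity
    simp only [he]
    field_simp
    ring
  · rw [hC]
    field_simp
    ring
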